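/- Let $p_1=2<p_2=3<p_3=5<\cdots$ be the sequence of all primes, and for $n=1,2,\ldots$ put $$A_n=\sum_{i=1}^{2n}(-1)^i p_i,\qquad T_n=A_n-2 .$$ Both sequences are strictly increasing sequences of integers. Assume the following two conjectures. (i) (Pillai) $\displaystyle\Big|\sum_{i=1}^{k}(-1)^{i-1}p_i\Big|\sim \frac{p_k}{2}$ as $k\to\infty$. (ii) The number of primes in the set $\{A_1,\ldots,A_n\}$ and the number of primes in the set $\{T_1,\ldots,T_n\}$ are both asymptotically equivalent to $\dfrac{2n}{\log n}$ as $n\to\infty$. Then each of the sequences $(A_n)$ and $(T_n)$ contains infinitely many primes, and if $r_k$ $(k=1,2,\ldots)$ denotes the $k$-th prime in the sequence $(A_n)$, or the $k$-th prime in the sequence $(T_n)$, then in either case $$r_k\sim\frac{k\log^2 k}{2}\qquad\text{as } k\to\infty .$$ -/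

import Mathlib

open Filter Asymptotics

namespace AlternatingPrimes

/-- The `i`-th prime `p i`, indexed from one: `p 1 = 2`, `p 2 = 3`, `p 3 = 5`, ...
(the value at `i = 0` is never used). -/
noncomputable def p (i : ℕ) : ℕ := Nat.nth Nat.Prime (i - 1)

/-- The alternating sum `A n = -p 1 + p 2 - p 3 + ... + p (2 n)`. -/
noncomputable def A (n : ℕ) : ℤ := ∑ i ∈ Finset.Icc 1 (2 * n), (-1) ^ i * (p i : ℤ)

/-- The shifted sequence `T n = A n - 2`. -/
noncomputable def T (n : ℕ) : ℤ := A n - 2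

theorem A_strictMono : StrictMono A := by
  refine strictMono_nat_of_lt_succ fun n => ?_
  have h : p (2 * n + 1) < p (2 * n + 2) := by
    unfold p
    exact Nat.nth_strictMono Nat.infinite_setOfPred_prime (by omega)
  have e : A (n + 1) = A n - p (2 * n + 1) + p (2 * n + 2) := by
    unfold A
    rw [show 2 * (n + 1) = 2 * n + 1 + 1 by ring, Finset.sum_Icc_succ_top (by omega),
      Finset.sum_Icc_succ_top (by omega)]
    have h1 : (-1 : ℤ) ^ (2 * n + 1) = -1 := Odd.neg_one_pow ⟨n, rfl⟩
    have h2 : (-1 : ℤ) ^ (2 * n + 1 + 1) = 1 := Even.neg_one_pow ⟨n + 1, by ring⟩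
    rw [h1, h2]
    ring
  omega

theorem T_strictMono : StrictMono T := fun _ _ h => sub_lt_sub_right (A_strictMono h) 2

/-- The term `a n` (with `n` at least one) of an integer sequence is a (positive) prime number. -/
def IsPrimeTerm (a : ℕ → ℤ) (n : ℕ) : Prop := 1 ≤ n ∧ ∃ q : ℕ, q.Prime ∧ a n = q

/-- The number of primes in the set `{a 1, ..., a n}`. -/
noncomputable def primeCount (a : ℕ → ℤ) (n : ℕ) : ℕ :=
  Set.ncard {q : ℕ | q.Prime ∧ ∃ i, 1 ≤ i ∧ i ≤ n ∧ a i = q}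

/-- The `k`-th prime (`k = 1, 2, ...`) in the sequence `a 1, a 2, ...`. It is meant for a strictly
increasing sequence with infinitely many prime terms. -/
noncomputable def kthPrime (a : ℕ → ℤ) (k : ℕ) : ℤ := a (Nat.nth (IsPrimeTerm a) (k - 1))

/-- Pillai's conjecture: `|∑_{i ≤ k} (-1)^(i-1) p_i| ~ p_k / 2` as `k → ∞`. -/
def PillaiConjecture : Prop :=
  (fun k : ℕ => |∑ i ∈ Finset.Icc 1 k, (-1 : ℝ) ^ (i - 1) * (p i : ℝ)|) ~[atTop]
    (fun k : ℕ => (p k : ℝ) / 2)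

/-- The conjecture that the numbers of primes in `{A 1, ..., A n}` and in `{T 1, ..., T n}` are
both asymptotic to `2 n / log n`. -/
def PrimeCountConjecture : Prop :=
  ((fun n : ℕ => (primeCount A n : ℝ)) ~[atTop] (fun n : ℕ => 2 * (n : ℝ) / Real.log n)) ∧
  ((fun n : ℕ => (primeCount T n : ℝ)) ~[atTop] (fun n : ℕ => 2 * (n : ℝ) / Real.log n))

end AlternatingPrimes

/-!
The hypotheses speak of the primes through their indices, so the size of the `k`-th prime, that is
the prime number theorem, has to be supplied. With it, Pillai's conjecture at `k = 2 n` gives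
`A n ~ p (2 n) / 2 ~ n log n`, and `T n = A n - 2` grows in the same way. If `N k` is the index of
the `k`-th prime term of either sequence, then exactly `k` of the terms up to that index are prime,
so the counting conjecture reads `k ~ 2 N k / log (N k)`. Inverting this relation
(`isEquivalent_mul_log_of_div_log`) gives `log (N k) ~ log k` and `N k ~ k log k / 2`, whence the
`k`-th prime is `~ N k * log (N k) ~ k (log k) ^ 2 / 2` (`kthPrime_isEquivalent`).

The prime number theorem is proved by the Wiener-Ikehara method. For a bounded function `h` whose
Laplace transform extends continuously to the imaginary axis, the means of `h` against a Fejér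
kernel are Fourier integrals of that extension over a bounded segment, so they tend to zero by the
Riemann-Lebesgue lemma (`tendsto_integral_mul_fejer`). The kernel being nonnegative and concentrated
near its centre, `h` tends to zero as soon as it cannot change too abruptly in one direction
(`tendsto_one_of_laplace`). This is applied to `exp (-u) * ψ (exp u) - 1`; the required
extension exists because `ζ` does not vanish on the line `re s = 1`, and boundedness is Chebyshev's
upper bound.
-/

namespace AlternatingPrimes

open MeasureTheory Real Topology

/-! ### The Fejér kernel -/

/-- The triangle function `max 0 (1 - |t|)`. -/
noncomputable def triangle (t : ℝ) : ℝ := max 0 (1 - |t|)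

/-- The Fejér kernel `(sin (x / 2) / (x / 2)) ^ 2`, the Fourier transform of `triangle`
in the normalization `∫ t, triangle t * exp (i t x)`; `sinc` makes its value one at zero. -/
noncomputable def fejer (x : ℝ) : ℝ := sinc (x / 2) ^ 2

theorem continuous_triangle : Continuous triangle := by
  unfold triangle; fun_prop

theorem triangle_nonneg (t : ℝ) : 0 ≤ triangle t := le_max_left _ _

theorem triangle_eq_zero {t : ℝ} (ht : 1 ≤ |t|) : triangle t = 0 :=
  max_eq_left (by linarith)

theorem hasCompactSupport_triangle : HasCompactSupport triangle := by
  refine HasCompactSupport.intro (isCompact_Icc (a := (-1 : ℝ)) (b := 1)) fun t ht => ?_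
  refine triangle_eq_zero ?_
  by_contra! h
  exact ht ⟨(abs_lt.1 h).1.le, (abs_lt.1 h).2.le⟩

theorem continuous_fejer : Continuous fejer := by
  unfold fejer
  exact (continuous_sinc.comp (continuous_id.div_const 2)).pow 2

theorem fejer_nonneg (x : ℝ) : 0 ≤ fejer x := sq_nonneg _

theorem fejer_le (x : ℝ) : fejer x ≤ 5 * (1 + x ^ 2)⁻¹ := by
  have h0 : 0 < 1 + x ^ 2 := by positivity
  rw [← div_eq_mul_inv, le_div_iff₀ h0]
  have h1 : fejer x ≤ 1 := by
    unfold fejer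
    rw [sq_le_one_iff_abs_le_one]
    exact abs_sinc_le_one _
  have h2 : fejer x * x ^ 2 ≤ 4 := by
    rcases eq_or_ne x 0 with rfl | hx
    · simp
    · unfold fejer
      rw [sinc_of_ne_zero (by positivity)]
      field_simp
      nlinarith [sin_sq_le_one (x / 2)]
  nlinarith

theorem integrable_fejer : Integrable fejer :=
  (integrable_inv_one_add_sq.const_mul 5).mono' continuous_fejer.aestronglyMeasurable
    (Eventually.of_forall fun x => by
      rw [norm_of_nonneg (fejer_nonneg x)]; exact fejer_le x)

theorem integral_fejer_pos : 0 < ∫ x, fejer x := by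
  refine integral_pos_of_integrable_nonneg_nonzero continuous_fejer integrable_fejer
    fejer_nonneg (x := 0) ?_
  simp [fejer]

theorem integral_triangle_mul_exp (x : ℝ) :
    ∫ t : ℝ, (triangle t : ℂ) * Complex.exp (t * x * Complex.I) = fejer x := by
  have hc : Continuous fun t : ℝ => (triangle t : ℂ) * Complex.exp (t * x * Complex.I) := by
    have := continuous_triangle
    fun_prop
  have hsupp : ∫ t : ℝ, (triangle t : ℂ) * Complex.exp (t * x * Complex.I) =
      ∫ t in (-1 : ℝ)..1, (triangle t : ℂ) * Complex.exp (t * x * Complex.I) := by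
    rw [intervalIntegral.integral_of_le (by norm_num),
      setIntegral_eq_integral_of_forall_compl_eq_zero]
    intro t ht
    rw [triangle_eq_zero]
    · simp
    · by_contra! h
      exact ht ⟨(abs_lt.1 h).1, (abs_lt.1 h).2.le⟩
  have hl : ∫ t in (-1 : ℝ)..0, (triangle t : ℂ) * Complex.exp (t * x * Complex.I) =
      ∫ t in (-1 : ℝ)..0, (1 + t : ℂ) * Complex.exp (t * x * Complex.I) := by
    refine intervalIntegral.integral_congr fun t ht => ?_
    rw [Set.uIcc_of_le (by norm_num)] at ht
    simp only [triangle, abs_of_nonpos ht.2]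
    rw [max_eq_right (by linarith [ht.1])]
    push_cast; ring
  have hr : ∫ t in (0 : ℝ)..1, (triangle t : ℂ) * Complex.exp (t * x * Complex.I) =
      ∫ t in (0 : ℝ)..1, (1 - t : ℂ) * Complex.exp (t * x * Complex.I) := by
    refine intervalIntegral.integral_congr fun t ht => ?_
    rw [Set.uIcc_of_le (by norm_num)] at ht
    simp only [triangle, abs_of_nonneg ht.1]
    rw [max_eq_right (by linarith [ht.2])]
    push_cast; ring
  rw [hsupp, ← intervalIntegral.integral_add_adjacent_intervals (b := 0)
    (hc.intervalIntegrable _ _) (hc.intervalIntegrable _ _), hl, hr]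
  have hid (t : ℝ) : HasDerivAt (fun t : ℝ => (t : ℂ)) 1 t := Complex.ofRealCLM.hasDerivAt
  rcases eq_or_ne x 0 with rfl | hx
  · have e1 : ∫ t in (-1 : ℝ)..0, (1 + t : ℂ) * Complex.exp (t * (0 : ℝ) * Complex.I) = 1 / 2 := by
      rw [intervalIntegral.integral_eq_sub_of_hasDerivAt
        (f := fun t : ℝ => (t : ℂ) + (t : ℂ) ^ 2 / 2)]
      · norm_num
      · intro t _
        refine ((hid t).add (((hid t).pow 2).div_const 2)).congr_deriv ?_
        simp
      · exact Continuous.intervalIntegrable (by fun_prop) _ _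
    have e2 : ∫ t in (0 : ℝ)..1, (1 - t : ℂ) * Complex.exp (t * (0 : ℝ) * Complex.I) = 1 / 2 := by
      rw [intervalIntegral.integral_eq_sub_of_hasDerivAt
        (f := fun t : ℝ => (t : ℂ) - (t : ℂ) ^ 2 / 2)]
      · norm_num
      · intro t _
        refine ((hid t).sub (((hid t).pow 2).div_const 2)).congr_deriv ?_
        simp
      · exact Continuous.intervalIntegrable (by fun_prop) _ _
    rw [e1, e2]
    simp [fejer]
    norm_num
  · have hx' : (x : ℂ) ≠ 0 := by exact_mod_cast hx
    have hexp (t : ℝ) : HasDerivAt (fun t : ℝ => Complex.exp (t * x * Complex.I))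
        (Complex.exp (t * x * Complex.I) * (x * Complex.I)) t := by
      convert (((hid t).mul_const (x : ℂ)).mul_const Complex.I).cexp using 1
      ring
    have e1 : ∫ t in (-1 : ℝ)..0, (1 + t : ℂ) * Complex.exp (t * x * Complex.I) =
        -Complex.I / x + 1 / x ^ 2 - Complex.exp (-x * Complex.I) / x ^ 2 := by
      rw [intervalIntegral.integral_eq_sub_of_hasDerivAt
        (f := fun t : ℝ => (1 + t : ℂ) * (Complex.exp (t * x * Complex.I) * (-Complex.I / x)) +
          Complex.exp (t * x * Complex.I) / x ^ 2)]
      · simp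
      · intro t _
        refine ((((hid t).const_add 1).mul ((hexp t).mul_const (-Complex.I / x))).add
          ((hexp t).div_const ((x : ℂ) ^ 2))).congr_deriv ?_
        field_simp
        linear_combination (-x * (1 + t)) * Complex.I_sq
      · exact Continuous.intervalIntegrable (by fun_prop) _ _
    have e2 : ∫ t in (0 : ℝ)..1, (1 - t : ℂ) * Complex.exp (t * x * Complex.I) =
        Complex.I / x + 1 / x ^ 2 - Complex.exp (x * Complex.I) / x ^ 2 := by
      rw [intervalIntegral.integral_eq_sub_of_hasDerivAt
        (f := fun t : ℝ => (1 - t : ℂ) * (Complex.exp (t * x * Complex.I) * (-Complex.I / x)) -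
          Complex.exp (t * x * Complex.I) / x ^ 2)]
      · simp; ring
      · intro t _
        refine ((((hid t).const_sub 1).mul ((hexp t).mul_const (-Complex.I / x))).sub
          ((hexp t).div_const ((x : ℂ) ^ 2))).congr_deriv ?_
        field_simp
        linear_combination (-x * (1 - t)) * Complex.I_sq
      · exact Continuous.intervalIntegrable (by fun_prop) _ _
    have hcos : (2 * Complex.cos x : ℂ) =
        Complex.exp (x * Complex.I) + Complex.exp (-x * Complex.I) := by
      rw [Complex.cos]; ring
    have hsin : (fejer x : ℂ) = (2 - 2 * Complex.cos x) / x ^ 2 := by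
      have : fejer x = (2 - 2 * cos x) / x ^ 2 := by
        unfold fejer
        rw [sinc_of_ne_zero (by positivity), show cos x = cos (2 * (x / 2)) by ring_nf, cos_two_mul]
        field_simp
        nlinarith [sin_sq_add_cos_sq (x / 2)]
      rw [this]; push_cast; rfl
    rw [e1, e2, hsin, hcos]
    ring

theorem integral_triangle_div_mul_exp {Λ : ℝ} (hΛ : 0 < Λ) (x : ℝ) :
    ∫ t : ℝ, (triangle (t / Λ) : ℂ) * Complex.exp (t * x * Complex.I) =
      (Λ * fejer (Λ * x) : ℝ) := by
  have := Measure.integral_comp_div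
    (fun t : ℝ => (triangle t : ℂ) * Complex.exp (t * (Λ * x : ℝ) * Complex.I)) Λ
  rw [integral_triangle_mul_exp, abs_of_pos hΛ] at this
  rw [Complex.ofReal_mul, ← Complex.real_smul, ← this]
  refine integral_congr_ae (Eventually.of_forall fun t => ?_)
  have : (Λ : ℂ) ≠ 0 := by exact_mod_cast hΛ.ne'
  simp only
  congr 2
  push_cast
  field_simp

/-! ### Fejér means and Laplace transforms -/

theorem fejer_integrable_comp {Λ : ℝ} (hΛ : 0 < Λ) (y : ℝ) :
    Integrable fun u : ℝ => Λ * fejer (Λ * (y - u)) :=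
  ((integrable_fejer.comp_mul_left' hΛ.ne').comp_sub_left y).const_mul Λ

/-- Smoothing a damped function against a Fejér kernel amounts to integrating its Laplace
transform over a segment of a vertical line. -/
theorem integral_damped_mul_fejer {h : ℝ → ℝ} {M : ℝ} {g : ℂ → ℂ} (hm : Measurable h)
    (hM : ∀ u, |h u| ≤ M)
    (hg : ∀ s : ℂ, 0 < s.re → ∫ u in Set.Ioi (0 : ℝ), (h u : ℂ) * Complex.exp (-s * u) = g s)
    {Λ ε : ℝ} (hΛ : 0 < Λ) (hε : 0 < ε) (y : ℝ) :
    ∫ u in Set.Ioi (0 : ℝ), ((h u * exp (-ε * u) * (Λ * fejer (Λ * (y - u))) : ℝ) : ℂ) =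
      ∫ t : ℝ, (triangle (t / Λ) : ℂ) * Complex.exp (t * y * Complex.I) * g (ε + t * Complex.I) := by
  have htri : Integrable fun t : ℝ => (triangle (t / Λ) : ℂ) := by
    refine (Continuous.integrable_of_hasCompactSupport continuous_triangle
      hasCompactSupport_triangle |>.comp_div hΛ.ne').ofReal
  have hexp : Integrable (fun u : ℝ => ((h u * exp (-ε * u) : ℝ) : ℂ))
      (volume.restrict (Set.Ioi 0)) := by
    refine Integrable.ofReal ?_
    refine Integrable.bdd_mul (c := M) (integrableOn_exp_mul_Ioi (by linarith) 0)
      hm.aestronglyMeasurable (Eventually.of_forall hM)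
  have hint : Integrable (Function.uncurry fun (u t : ℝ) =>
      ((h u * exp (-ε * u) : ℝ) : ℂ) * (triangle (t / Λ) : ℂ) *
        Complex.exp (t * (y - u : ℝ) * Complex.I)) ((volume.restrict (Set.Ioi 0)).prod volume) := by
    refine (hexp.mul_prod htri).mul_bdd (c := 1) ?_ (Eventually.of_forall fun z => ?_)
    · exact Continuous.aestronglyMeasurable (by fun_prop)
    · rw [← Complex.ofReal_mul, Complex.norm_exp_ofReal_mul_I]
  calc _ = ∫ u in Set.Ioi (0 : ℝ), ∫ t : ℝ, ((h u * exp (-ε * u) : ℝ) : ℂ) *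
          (triangle (t / Λ) : ℂ) * Complex.exp (t * (y - u : ℝ) * Complex.I) := by
        refine integral_congr_ae (Eventually.of_forall fun u => ?_)
        simp only [mul_assoc]
        rw [integral_const_mul]
        simp only [← mul_assoc]
        rw [integral_triangle_div_mul_exp hΛ]
        push_cast
        ring
    _ = ∫ t : ℝ, ∫ u in Set.Ioi (0 : ℝ), ((h u * exp (-ε * u) : ℝ) : ℂ) *
          (triangle (t / Λ) : ℂ) * Complex.exp (t * (y - u : ℝ) * Complex.I) :=
        integral_integral_swap hint
    _ = _ := by
        refine integral_congr_ae (Eventually.of_forall fun t => ?_)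
        simp only
        rw [← hg _ (by simpa using hε), ← integral_const_mul]
        refine integral_congr_ae (Eventually.of_forall fun u => ?_)
        simp only
        have : Complex.exp (-(ε + t * Complex.I) * u) =
            Complex.exp (-ε * u) * Complex.exp (-(t * u * Complex.I)) := by
          rw [← Complex.exp_add]; ring_nf
        rw [this]
        have : Complex.exp (t * (y - u : ℝ) * Complex.I) =
            Complex.exp (t * y * Complex.I) * Complex.exp (-(t * u * Complex.I)) := by
          rw [← Complex.exp_add]; push_cast; ring_nf
        rw [this]
        push_cast
        ring

/-- The limit of `integral_damped_mul_fejer` as the damping is removed. -/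
theorem integral_mul_fejer {h : ℝ → ℝ} {M : ℝ} {g : ℂ → ℂ} (hm : Measurable h)
    (hM : ∀ u, |h u| ≤ M)
    (hg : ∀ s : ℂ, 0 < s.re → ∫ u in Set.Ioi (0 : ℝ), (h u : ℂ) * Complex.exp (-s * u) = g s)
    (hgc : ContinuousOn g {s | 0 ≤ s.re}) {Λ : ℝ} (hΛ : 0 < Λ) (y : ℝ) :
    ∫ u in Set.Ioi (0 : ℝ), ((h u * (Λ * fejer (Λ * (y - u))) : ℝ) : ℂ) =
      ∫ t : ℝ, (triangle (t / Λ) : ℂ) * Complex.exp (t * y * Complex.I) * g (t * Complex.I) := by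
  have hM0 : 0 ≤ M := (abs_nonneg _).trans (hM 0)
  have hcpt : IsCompact (Set.Icc (0 : ℝ) 1 ×ˢ Set.Icc (-Λ) Λ) := isCompact_Icc.prod isCompact_Icc
  obtain ⟨C, hC⟩ := hcpt.exists_bound_of_continuousOn
    (f := fun z : ℝ × ℝ => g (z.1 + z.2 * Complex.I)) (by
      refine hgc.comp (by fun_prop) fun z hz => ?_
      simpa using hz.1.1)
  have hI : ∀ᶠ ε : ℝ in 𝓝[>] 0, ε ∈ Set.Ioc (0 : ℝ) 1 := Ioc_mem_nhdsGT one_pos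
  have hL : Tendsto (fun ε : ℝ => ∫ u in Set.Ioi (0 : ℝ),
      ((h u * exp (-ε * u) * (Λ * fejer (Λ * (y - u))) : ℝ) : ℂ)) (𝓝[>] 0)
      (𝓝 (∫ u in Set.Ioi (0 : ℝ), ((h u * (Λ * fejer (Λ * (y - u))) : ℝ) : ℂ))) := by
    refine tendsto_integral_filter_of_dominated_convergence
      (fun u => M * (Λ * fejer (Λ * (y - u)))) ?_ ?_
      ((fejer_integrable_comp hΛ y).const_mul M).restrict ?_
    · refine Eventually.of_forall fun ε => Measurable.aestronglyMeasurable ?_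
      have := continuous_fejer.measurable
      fun_prop
    · filter_upwards [hI] with ε hε
      refine (ae_restrict_iff' measurableSet_Ioi).2 (Eventually.of_forall fun u hu => ?_)
      have hk : 0 ≤ Λ * fejer (Λ * (y - u)) := mul_nonneg hΛ.le (fejer_nonneg _)
      rw [Complex.norm_real, norm_mul, norm_of_nonneg hk, norm_mul, norm_of_nonneg (exp_pos _).le]
      refine mul_le_mul_of_nonneg_right ?_ hk
      have : exp (-ε * u) ≤ 1 := exp_le_one_iff.2 (by nlinarith [hε.1, Set.mem_Ioi.1 hu])
      calc ‖h u‖ * exp (-ε * u) ≤ M * 1 := by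
            gcongr
            exact hM u
        _ = M := mul_one M
    · refine Eventually.of_forall fun u => ?_
      refine tendsto_nhdsWithin_of_tendsto_nhds ?_
      have : Continuous fun ε : ℝ => ((h u * exp (-ε * u) * (Λ * fejer (Λ * (y - u))) : ℝ) : ℂ) := by
        fun_prop
      simpa using this.tendsto 0
  have hR : Tendsto (fun ε : ℝ => ∫ t : ℝ, (triangle (t / Λ) : ℂ) *
      Complex.exp (t * y * Complex.I) * g (ε + t * Complex.I)) (𝓝[>] 0)
      (𝓝 (∫ t : ℝ, (triangle (t / Λ) : ℂ) * Complex.exp (t * y * Complex.I) *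
        g (t * Complex.I))) := by
    refine tendsto_integral_filter_of_dominated_convergence
      (fun t => triangle (t / Λ) * C) ?_ ?_ ?_ ?_
    · filter_upwards [hI] with ε hε
      have h1 : Continuous fun t : ℝ => g (ε + t * Complex.I) := by
        refine hgc.comp_continuous (by fun_prop) fun t => ?_
        simpa using hε.1.le
      have := continuous_triangle
      exact Continuous.aestronglyMeasurable (Continuous.mul (by fun_prop) h1)
    · filter_upwards [hI] with ε hε
      refine Eventually.of_forall fun t => ?_
      rw [norm_mul, norm_mul, Complex.norm_real, norm_of_nonneg (triangle_nonneg _),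
        ← Complex.ofReal_mul, Complex.norm_exp_ofReal_mul_I, mul_one]
      by_cases ht : |t| ≤ Λ
      · exact mul_le_mul_of_nonneg_left (hC (ε, t) ⟨⟨hε.1.le, hε.2⟩, abs_le.1 ht⟩)
          (triangle_nonneg _)
      · rw [triangle_eq_zero]
        · simp
        · rw [abs_div, abs_of_pos hΛ, one_le_div hΛ]
          exact (not_le.1 ht).le
    · exact (Continuous.integrable_of_hasCompactSupport continuous_triangle
        hasCompactSupport_triangle |>.comp_div hΛ.ne').mul_const C
    · refine Eventually.of_forall fun t => ?_
      refine Tendsto.const_mul _ ?_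
      have h1 : Tendsto (fun ε : ℝ => (ε + t * Complex.I : ℂ)) (𝓝[>] 0)
          (𝓝[{s | 0 ≤ s.re}] (t * Complex.I)) := by
        refine tendsto_nhdsWithin_iff.2 ⟨tendsto_nhdsWithin_of_tendsto_nhds ?_, ?_⟩
        · have : Continuous fun ε : ℝ => (ε + t * Complex.I : ℂ) := by fun_prop
          simpa using this.tendsto 0
        · filter_upwards [hI] with ε hε
          simpa using hε.1.le
      exact (hgc (t * Complex.I) (by simp)).tendsto.comp h1
  refine tendsto_nhds_unique hL (hR.congr' ?_)
  filter_upwards [hI] with ε hε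
  exact (integral_damped_mul_fejer hm hM hg hΛ hε.1 y).symm

/-- The Fejér means of a bounded function whose Laplace transform extends continuously to the
imaginary axis tend to zero, by the Riemann-Lebesgue lemma. -/
theorem tendsto_integral_mul_fejer {h : ℝ → ℝ} {M : ℝ} {g : ℂ → ℂ} (hm : Measurable h)
    (hM : ∀ u, |h u| ≤ M)
    (hg : ∀ s : ℂ, 0 < s.re → ∫ u in Set.Ioi (0 : ℝ), (h u : ℂ) * Complex.exp (-s * u) = g s)
    (hgc : ContinuousOn g {s | 0 ≤ s.re}) {Λ : ℝ} (hΛ : 0 < Λ) :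
    Tendsto (fun y : ℝ => ∫ u in Set.Ioi (0 : ℝ), h u * (Λ * fejer (Λ * (y - u)))) atTop (𝓝 0) := by
  have hRL := Real.tendsto_integral_exp_smul_cocompact
    (fun t : ℝ => (triangle (t / Λ) : ℂ) * g (t * Complex.I))
  have hy : Tendsto (fun y : ℝ => -(y / (2 * π))) atTop (cocompact ℝ) :=
    (tendsto_neg_atTop_atBot.comp
      (tendsto_id.atTop_div_const (by positivity))).mono_right atBot_le_cocompact
  have h1 := hRL.comp hy
  have h2 : Tendsto (fun y : ℝ =>
      ((∫ u in Set.Ioi (0 : ℝ), h u * (Λ * fejer (Λ * (y - u))) : ℝ) : ℂ)) atTop (𝓝 0) := by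
    refine h1.congr fun y => ?_
    rw [← integral_complex_ofReal, integral_mul_fejer hm hM hg hgc hΛ y]
    refine integral_congr_ae (Eventually.of_forall fun t => ?_)
    simp only
    rw [Circle.smul_def, smul_eq_mul, Real.fourierChar_apply]
    have : ((2 * π * -(t * -(y / (2 * π))) : ℝ) : ℂ) * Complex.I = t * y * Complex.I := by
      rw [← Complex.ofReal_mul]
      congr 2
      field_simp
    rw [this]
    ring
  exact tendsto_ofReal_iff.1 h2

/-! ### A Tauberian theorem -/

/-- A bounded function cannot stay above `δ` on intervals of fixed length arbitrarily far out if all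
its Fejér means tend to zero, because a narrow Fejér kernel has most of its mass on such an
interval. -/
theorem not_frequently_ge_on_interval {h : ℝ → ℝ} {M : ℝ} (hm : Measurable h)
    (hM : ∀ u, |h u| ≤ M)
    (hlim : ∀ Λ : ℝ, 0 < Λ →
      Tendsto (fun y : ℝ => ∫ u in Set.Ioi (0 : ℝ), h u * (Λ * fejer (Λ * (y - u)))) atTop (𝓝 0))
    {δ r : ℝ} (hδ : 0 < δ) (hr : 0 < r) :
    ¬ ∃ᶠ y in atTop, ∀ u ∈ Set.Icc (y - r) (y + r), δ ≤ h u := by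
  have hM0 : 0 ≤ M := (abs_nonneg _).trans (hM 0)
  set c := ∫ x, fejer x with hc
  have hc0 : 0 < c := integral_fejer_pos
  -- `Λ` is chosen so large that the interval carries more than the share `M / (M + δ)` of the mass.
  obtain ⟨R, hR0, hR⟩ : ∃ R : ℝ, 0 < R ∧ M * c < (δ + M) * ∫ x in (-R)..R, fejer x := by
    have ht := intervalIntegral_tendsto_integral integrable_fejer tendsto_neg_atTop_atBot tendsto_id
    have ht' := ht.const_mul (δ + M)
    have : M * c < (δ + M) * c := by nlinarith
    obtain ⟨R, h1, h2⟩ := ((ht'.eventually_const_lt this).and (eventually_gt_atTop 0)).exists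
    exact ⟨R, h2, h1⟩
  set κ := (δ + M) * (∫ x in (-R)..R, fejer x) - M * c with hκ
  have hκ0 : 0 < κ := by linarith
  set Λ := R / r with hΛdef
  have hΛ : 0 < Λ := div_pos hR0 hr
  intro hfreq
  have hev : ∀ᶠ y in atTop, ∫ u in Set.Ioi (0 : ℝ), h u * (Λ * fejer (Λ * (y - u))) < κ :=
    (hlim Λ hΛ).eventually_lt_const hκ0
  obtain ⟨y, hyδ, hy, hyr⟩ := (hfreq.and_eventually (hev.and (eventually_gt_atTop r))).exists
  have hk (u : ℝ) : 0 ≤ Λ * fejer (Λ * (y - u)) := mul_nonneg hΛ.le (fejer_nonneg _)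
  have hki := fejer_integrable_comp hΛ y
  have htotal : ∫ u, Λ * fejer (Λ * (y - u)) = c := by
    rw [integral_const_mul, integral_sub_left_eq_self (fun u => fejer (Λ * u)),
      Measure.integral_comp_mul_left, abs_of_pos (inv_pos.2 hΛ), smul_eq_mul,
      mul_inv_cancel_left₀ hΛ.ne']
  have hcenter : ∫ u in Set.Ioc (y - r) (y + r), Λ * fejer (Λ * (y - u)) =
      ∫ x in (-R)..R, fejer x := by
    rw [← intervalIntegral.integral_of_le (by linarith), intervalIntegral.integral_const_mul,
      intervalIntegral.integral_comp_sub_left (fun u => fejer (Λ * u)),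
      intervalIntegral.integral_comp_mul_left _ hΛ.ne', smul_eq_mul, mul_inv_cancel_left₀ hΛ.ne']
    have : Λ * r = R := div_mul_cancel₀ _ hr.ne'
    congr 1
    · linarith
    · linarith
  have hind : ∫ u in Set.Ioi (0 : ℝ), h u * (Λ * fejer (Λ * (y - u))) =
      ∫ u, (Set.Ioi (0 : ℝ)).indicator (fun u => h u * (Λ * fejer (Λ * (y - u)))) u :=
    (integral_indicator measurableSet_Ioi).symm
  have hge : κ ≤ ∫ u in Set.Ioi (0 : ℝ), h u * (Λ * fejer (Λ * (y - u))) := by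
    rw [hκ, hind, ← htotal, ← hcenter, ← integral_const_mul, ← integral_const_mul,
      ← integral_indicator measurableSet_Ioc, ← integral_sub]
    · refine integral_mono ?_ ?_ fun u => ?_
      · exact ((hki.const_mul _).indicator measurableSet_Ioc).sub (hki.const_mul _)
      · exact (hki.bdd_mul (c := M) hm.aestronglyMeasurable
          (Eventually.of_forall hM)).indicator measurableSet_Ioi
      · simp only
        by_cases hu : u ∈ Set.Ioc (y - r) (y + r)
        · rw [Set.indicator_of_mem hu, Set.indicator_of_mem (by
            rw [Set.mem_Ioi]; linarith [hu.1])]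
          nlinarith [hk u, hyδ u ⟨hu.1.le, hu.2⟩]
        · rw [Set.indicator_of_notMem hu]
          by_cases hu0 : u ∈ Set.Ioi (0 : ℝ)
          · rw [Set.indicator_of_mem hu0]
            nlinarith [hk u, (abs_le.1 (hM u)).1]
          · rw [Set.indicator_of_notMem hu0]
            nlinarith [hk u]
    · exact (hki.const_mul _).indicator measurableSet_Ioc
    · exact hki.const_mul _
  linarith

/-- A Wiener-Ikehara theorem: a bounded function `S` for which `u ↦ exp u * S u` is monotone tends
to one if the Laplace transform of `S - 1` extends continuously to the imaginary axis. -/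
theorem tendsto_one_of_laplace {S : ℝ → ℝ} {M : ℝ} {g : ℂ → ℂ} (hm : Measurable S)
    (hM : ∀ u, |S u - 1| ≤ M) (hmono : Monotone fun u => exp u * S u) (hS0 : ∀ u, 0 ≤ S u)
    (hg : ∀ s : ℂ, 0 < s.re →
      ∫ u in Set.Ioi (0 : ℝ), ((S u - 1 : ℝ) : ℂ) * Complex.exp (-s * u) = g s)
    (hgc : ContinuousOn g {s | 0 ≤ s.re}) :
    Tendsto S atTop (𝓝 1) := by
  have hm' : Measurable fun u => S u - 1 := hm.sub_const 1
  have hlim := fun Λ hΛ => tendsto_integral_mul_fejer (Λ := Λ) hm' hM hg hgc hΛ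
  have hup (δ : ℝ) (hδ : 0 < δ) : ∀ᶠ y in atTop, S y < 1 + δ := by
    by_contra hcon
    obtain ⟨r, hr0, hr⟩ : ∃ r : ℝ, 0 < r ∧ 1 + δ / 2 < (1 + δ) * exp (-(2 * r)) := by
      have : Tendsto (fun r : ℝ => (1 + δ) * exp (-(2 * r))) (𝓝[>] 0) (𝓝 ((1 + δ) * 1)) := by
        refine tendsto_nhdsWithin_of_tendsto_nhds ?_
        have h1 : Continuous fun r : ℝ => (1 + δ) * exp (-(2 * r)) := by fun_prop
        simpa using h1.tendsto 0
      obtain ⟨r, h1, h2⟩ := ((this.eventually_const_lt (u := 1 + δ / 2) (by linarith)).and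
        self_mem_nhdsWithin).exists
      exact ⟨r, h2, h1⟩
    refine not_frequently_ge_on_interval hm' hM hlim (half_pos hδ) hr0 ?_
    have hf : ∃ᶠ y in atTop, 1 + δ ≤ S y := by
      simpa [Filter.Frequently] using hcon
    -- Monotonicity propagates a large value at `y` to `[y, y + 2 * r]`.
    refine (tendsto_atTop_add_const_right atTop r tendsto_id).frequently
      (hf.mono fun y hy u hu => ?_)
    have h1 : exp y * S y ≤ exp u * S u := hmono (by simpa using hu.1)
    have h2 : exp (-(2 * r)) ≤ exp (y - u) := exp_le_exp.2 (by
      have := hu.2; simp only [id] at this; linarith)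
    have h3 : exp (y - u) * S y ≤ S u := by
      rw [exp_sub, div_mul_eq_mul_div, div_le_iff₀ (exp_pos u)]
      linarith
    have h4 : (1 + δ) * exp (-(2 * r)) ≤ exp (y - u) * S y := by
      rw [mul_comm]
      gcongr
    linarith
  have hdown (δ : ℝ) (hδ : 0 < δ) : ∀ᶠ y in atTop, 1 - δ < S y := by
    by_contra hcon
    obtain ⟨r, hr0, hr⟩ : ∃ r : ℝ, 0 < r ∧ (1 - δ) * exp (2 * r) < 1 - δ / 2 := by
      have : Tendsto (fun r : ℝ => (1 - δ) * exp (2 * r)) (𝓝[>] 0) (𝓝 ((1 - δ) * 1)) := by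
        refine tendsto_nhdsWithin_of_tendsto_nhds ?_
        have h1 : Continuous fun r : ℝ => (1 - δ) * exp (2 * r) := by fun_prop
        simpa using h1.tendsto 0
      obtain ⟨r, h1, h2⟩ := ((this.eventually_lt_const (u := 1 - δ / 2) (by linarith)).and
        self_mem_nhdsWithin).exists
      exact ⟨r, h2, h1⟩
    refine not_frequently_ge_on_interval (h := fun u => -(S u - 1)) hm'.neg
      (fun u => by rw [abs_neg]; exact hM u) (fun Λ hΛ => ?_) (half_pos hδ) hr0 ?_
    · simpa only [neg_mul, integral_neg, neg_zero] using (hlim Λ hΛ).neg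
    have hf : ∃ᶠ y in atTop, S y ≤ 1 - δ := by
      simpa [Filter.Frequently] using hcon
    -- Monotonicity propagates a small value at `y` back to `[y - 2 * r, y]`.
    refine (tendsto_atTop_add_const_right atTop (-r) tendsto_id).frequently
      (hf.mono fun y hy u hu => ?_)
    have hu1 := hu.1
    have hu2 := hu.2
    simp only [id] at hu1 hu2
    have h1 : exp u * S u ≤ exp y * S y := hmono (by linarith)
    have h2 : exp (y - u) ≤ exp (2 * r) := exp_le_exp.2 (by linarith)
    have h3 : S u ≤ exp (y - u) * S y := by
      rw [exp_sub, div_mul_eq_mul_div, le_div_iff₀ (exp_pos u)]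
      linarith
    have h4 : exp (y - u) * S y ≤ exp (2 * r) * (1 - δ) :=
      mul_le_mul h2 hy (hS0 y) (exp_pos _).le
    linarith
  rw [Metric.tendsto_atTop']
  intro δ hδ
  obtain ⟨N, hN⟩ := eventually_atTop.1 ((hup δ hδ).and (hdown δ hδ))
  refine ⟨N, fun y hy => ?_⟩
  rw [Real.dist_eq, abs_lt]
  constructor <;> linarith [(hN y hy.le).1, (hN y hy.le).2]

/-! ### The prime number theorem -/

/-- `x ↦ exp x` turns an integral over `(1, ∞)` into one over `(0, ∞)`. -/
theorem integral_Ioi_one_eq_comp_exp (f : ℝ → ℂ) :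
    ∫ x in Set.Ioi (1 : ℝ), f x = ∫ u in Set.Ioi (0 : ℝ), (exp u : ℂ) * f (exp u) := by
  have himg : exp '' Set.Ioi 0 = Set.Ioi 1 := by
    ext x
    constructor
    · rintro ⟨u, hu, rfl⟩
      exact one_lt_exp_iff.2 hu
    · intro hx
      exact ⟨log x, log_pos hx, exp_log (zero_lt_one.trans hx)⟩
  rw [← himg, integral_image_eq_integral_abs_deriv_smul measurableSet_Ioi
    (fun u _ => (hasDerivAt_exp u).hasDerivWithinAt) exp_injective.injOn]
  refine integral_congr_ae (Eventually.of_forall fun u => ?_)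
  simp [abs_of_pos (exp_pos u)]

theorem sum_vonMangoldt_isBigO :
    (fun n : ℕ => ∑ k ∈ Finset.Icc 1 n, ArithmeticFunction.vonMangoldt k) =O[atTop]
      fun n : ℕ => (n : ℝ) ^ (1 : ℝ) := by
  refine IsBigO.of_bound (log 4 + 4) (Eventually.of_forall fun n => ?_)
  have h := Chebyshev.psi_le_const_mul_self (x := n) n.cast_nonneg
  have h0 := Chebyshev.psi_nonneg n
  simp only [Chebyshev.psi, Nat.floor_natCast] at h h0
  have e : Finset.Icc 1 n = Finset.Ioc 0 n := rfl
  rw [e, rpow_one, norm_of_nonneg h0, norm_of_nonneg n.cast_nonneg]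
  exact h

theorem exp_neg_mul_psi_exp_nonneg (u : ℝ) : 0 ≤ exp (-u) * Chebyshev.psi (exp u) :=
  mul_nonneg (exp_pos _).le (Chebyshev.psi_nonneg _)

theorem exp_neg_mul_psi_exp_le (u : ℝ) : exp (-u) * Chebyshev.psi (exp u) ≤ log 4 + 4 := by
  rw [exp_neg, inv_mul_le_iff₀ (exp_pos u), mul_comm]
  exact Chebyshev.psi_le_const_mul_self (exp_pos u).le

/-- The Laplace transform of `exp (-u) * ψ (exp u) - 1` extends continuously to the closed right
half-plane. This rests on the nonvanishing of `ζ` on the line `re s = 1`, which enters through the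
continuity of `LFunctionResidueClassAux` for modulus one, that is, of `-ζ' / ζ` minus its pole. -/
theorem exists_laplace_psi :
    ∃ g : ℂ → ℂ, ContinuousOn g {s | 0 ≤ s.re} ∧ ∀ s : ℂ, 0 < s.re →
      ∫ u in Set.Ioi (0 : ℝ),
        ((exp (-u) * Chebyshev.psi (exp u) - 1 : ℝ) : ℂ) * Complex.exp (-s * u) = g s := by
  set F := ArithmeticFunction.vonMangoldt.LFunctionResidueClassAux (1 : ZMod 1) with hF
  refine ⟨fun s => (F (s + 1) - 1) / (s + 1), ?_, fun s hs => ?_⟩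
  · have h1 : ContinuousOn (fun s : ℂ => F (s + 1)) {s | 0 ≤ s.re} :=
      (ArithmeticFunction.vonMangoldt.continuousOn_LFunctionResidueClassAux (1 : ZMod 1)).comp
        (by fun_prop) fun s hs => by
          have : 0 ≤ s.re := hs
          simpa using this
    refine (h1.sub continuousOn_const).div (by fun_prop) fun s hs h0 => ?_
    have : 0 ≤ s.re := hs
    have h2 := congrArg Complex.re h0
    simp at h2
    linarith
  -- With `L` the Dirichlet series of the von Mangoldt function, the transform is
  -- `L (s + 1) / (s + 1) - 1 / s`, and `F (s + 1) = L (s + 1) - 1 / s`.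
  · have hs0 : s ≠ 0 := fun h => by simp [h] at hs
    have hs1 : s + 1 ≠ 0 := fun h => by
      have h2 := congrArg Complex.re h
      simp at h2
      linarith
    have hre : (1 : ℝ) < (s + 1).re := by simpa using hs
    have hFs : F (s + 1) = LSeries (fun n => (ArithmeticFunction.vonMangoldt n : ℂ)) (s + 1) -
        1 / s := by
      have := ArithmeticFunction.vonMangoldt.eqOn_LFunctionResidueClassAux (q := 1) (a := 1)
        isUnit_one hre
      rw [← hF] at this
      rw [this]
      have hcl : ArithmeticFunction.vonMangoldt.residueClass (1 : ZMod 1) =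
          fun n => ArithmeticFunction.vonMangoldt n := by
        ext n
        exact Set.indicator_of_mem (show n ∈ {m : ℕ | (m : ZMod 1) = 1} from
          Subsingleton.elim (n : ZMod 1) 1) _
      simp [hcl]
    have hL := LSeries_eq_mul_integral_of_nonneg (fun n => ArithmeticFunction.vonMangoldt n)
      zero_le_one hre sum_vonMangoldt_isBigO fun n => ArithmeticFunction.vonMangoldt_nonneg
    rw [integral_Ioi_one_eq_comp_exp] at hL
    have hconv : ∫ u in Set.Ioi (0 : ℝ), (exp u : ℂ) *
        ((∑ k ∈ Finset.Icc 1 ⌊exp u⌋₊, (ArithmeticFunction.vonMangoldt k : ℂ)) *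
          (exp u : ℂ) ^ (-(s + 1 + 1))) =
        ∫ u in Set.Ioi (0 : ℝ), ((exp (-u) * Chebyshev.psi (exp u) : ℝ) : ℂ) *
          Complex.exp (-s * u) := by
      refine integral_congr_ae (Eventually.of_forall fun u => ?_)
      simp only
      have hpsi : Chebyshev.psi (exp u) =
          ∑ k ∈ Finset.Icc 1 ⌊exp u⌋₊, ArithmeticFunction.vonMangoldt k := rfl
      rw [hpsi, Complex.ofReal_mul, Complex.ofReal_sum, Complex.ofReal_exp, Complex.ofReal_exp,
        Complex.cpow_def_of_ne_zero (Complex.exp_ne_zero _), ← Complex.ofReal_exp,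
        ← Complex.ofReal_log (exp_pos u).le, log_exp, Complex.ofReal_exp]
      have : Complex.exp u * Complex.exp (u * -(s + 1 + 1)) =
          Complex.exp ((-u : ℝ)) * Complex.exp (-s * u) := by
        rw [← Complex.exp_add, ← Complex.exp_add]
        push_cast
        ring_nf
      linear_combination (∑ k ∈ Finset.Icc 1 ⌊exp u⌋₊,
        (ArithmeticFunction.vonMangoldt k : ℂ)) * this
    rw [hconv] at hL
    have hexp : IntegrableOn (fun u : ℝ => Complex.exp (-s * u)) (Set.Ioi 0) :=
      integrableOn_exp_mul_complex_Ioi (by simpa using hs) 0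
    have hi : IntegrableOn (fun u : ℝ => ((exp (-u) * Chebyshev.psi (exp u) : ℝ) : ℂ) *
        Complex.exp (-s * u)) (Set.Ioi 0) := by
      refine Integrable.bdd_mul (c := log 4 + 4) hexp ?_ (Eventually.of_forall fun u => ?_)
      · have := Chebyshev.psi_mono.measurable
        exact Measurable.aestronglyMeasurable (by fun_prop)
      · rw [Complex.norm_real, norm_of_nonneg (exp_neg_mul_psi_exp_nonneg u)]
        exact exp_neg_mul_psi_exp_le u
    have h1 : ∫ u in Set.Ioi (0 : ℝ), Complex.exp (-s * u) = 1 / s := by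
      rw [integral_exp_mul_complex_Ioi (by simpa using hs)]
      simp
    have hsplit : ∫ u in Set.Ioi (0 : ℝ),
        ((exp (-u) * Chebyshev.psi (exp u) - 1 : ℝ) : ℂ) * Complex.exp (-s * u) =
        (∫ u in Set.Ioi (0 : ℝ), ((exp (-u) * Chebyshev.psi (exp u) : ℝ) : ℂ) *
          Complex.exp (-s * u)) - ∫ u in Set.Ioi (0 : ℝ), Complex.exp (-s * u) := by
      rw [← integral_sub hi hexp]
      refine integral_congr_ae (Eventually.of_forall fun u => ?_)
      simp only
      push_cast
      ring
    rw [hsplit, h1]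
    simp only
    rw [hFs, hL]
    field_simp
    ring

/-- The prime number theorem for Chebyshev's function `ψ`. -/
theorem psi_isEquivalent_id : Chebyshev.psi ~[atTop] fun x => x := by
  obtain ⟨g, hgc, hg⟩ := exists_laplace_psi
  have hb (u : ℝ) : |exp (-u) * Chebyshev.psi (exp u) - 1| ≤ log 4 + 4 := by
    have h0 := exp_neg_mul_psi_exp_nonneg u
    have h1 := exp_neg_mul_psi_exp_le u
    have h2 : 0 ≤ log 4 := log_nonneg (by norm_num)
    rw [abs_le]
    constructor <;> linarith
  have hlim : Tendsto (fun u => exp (-u) * Chebyshev.psi (exp u)) atTop (𝓝 1) := by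
    refine tendsto_one_of_laplace ?_ hb ?_ ?_ hg hgc
    · have := Chebyshev.psi_mono.measurable
      fun_prop
    · have : (fun u => exp u * (exp (-u) * Chebyshev.psi (exp u))) =
          fun u => Chebyshev.psi (exp u) := by
        ext u
        rw [← mul_assoc, ← exp_add]
        simp
      rw [this]
      exact Chebyshev.psi_mono.comp exp_monotone
    · exact exp_neg_mul_psi_exp_nonneg
  rw [isEquivalent_iff_tendsto_one (eventually_ne_atTop 0)]
  refine (hlim.comp tendsto_log_atTop).congr' ?_
  filter_upwards [eventually_gt_atTop 0] with x hx
  simp only [Function.comp, Pi.div_apply]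
  rw [exp_neg, exp_log hx]
  ring

/-- The prime number theorem for the prime counting function. -/
theorem primeCounting_isEquivalent :
    (fun x : ℝ => (Nat.primeCounting ⌊x⌋₊ : ℝ)) ~[atTop] fun x => x / log x := by
  have hsqrt : (fun x : ℝ => √x) =o[atTop] fun x : ℝ => x := by
    refine (isLittleO_iff_tendsto' ?_).2 (tendsto_sqrt_atTop.inv_tendsto_atTop.congr' ?_)
    · filter_upwards [eventually_gt_atTop 0] with x hx h
      exact absurd h hx.ne'
    · filter_upwards [eventually_gt_atTop 0] with x hx
      rw [sqrt_div_self', one_div, Pi.inv_apply]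
  have htheta : Chebyshev.theta ~[atTop] fun x => x := by
    have h := psi_isEquivalent_id.sub_isLittleO
      (Chebyshev.isBigO_psi_sub_theta_sqrt.trans_isLittleO hsqrt)
    simpa using h
  have hlog : (fun x : ℝ => x / log x ^ 2) =o[atTop] fun x : ℝ => x / log x := by
    refine (isLittleO_iff_tendsto' ?_).2 (tendsto_log_atTop.inv_tendsto_atTop.congr' ?_)
    · filter_upwards [eventually_gt_atTop 1] with x hx h
      have := log_pos hx
      have : x / log x ≠ 0 := by positivity
      contradiction
    · filter_upwards [eventually_gt_atTop 1] with x hx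
      have := log_pos hx
      simp only [Pi.inv_apply]
      field_simp
  have h := (htheta.div (IsEquivalent.refl (u := log))).add_isLittleO
    (Chebyshev.primeCounting_sub_theta_div_log_isBigO.trans_isLittleO hlog)
  refine h.congr_left (Eventually.of_forall fun x => ?_)
  simp

/-! ### Asymptotic inversion and the size of the `k`-th prime -/

/-- If `m ~ x / log x`, then `log m ~ log x` and `x ~ m * log m`, since `log (log x) = o(log x)`. -/
theorem isEquivalent_mul_log_of_div_log {α : Type*} {l : Filter α} {m x : α → ℝ}
    (hm : Tendsto m l atTop) (hx : Tendsto x l atTop) (h : m ~[l] fun i => x i / log (x i)) :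
    ((fun i => log (m i)) ~[l] fun i => log (x i)) ∧ (fun i => m i * log (m i)) ~[l] x := by
  have h1 : (fun i => log (m i)) ~[l] fun i => log (x i / log (x i)) :=
    h.log (h.tendsto_atTop hm)
  have hll : (fun i => log (log (x i))) =o[l] fun i => log (x i) :=
    isLittleO_log_id_atTop.comp_tendsto (tendsto_log_atTop.comp hx)
  have h2 : (fun i => log (x i / log (x i))) ~[l] fun i => log (x i) := by
    refine (IsEquivalent.refl.sub_isLittleO hll).congr_left ?_
    filter_upwards [hx.eventually_gt_atTop 1] with i hi
    rw [log_div (by positivity) (log_pos hi).ne']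
    rfl
  refine ⟨h1.trans h2, (h.mul (h1.trans h2)).congr_right ?_⟩
  filter_upwards [hx.eventually_gt_atTop 1] with i hi
  exact div_mul_cancel₀ _ (log_pos hi).ne'

theorem primeCounting_p {k : ℕ} (hk : 1 ≤ k) : Nat.primeCounting (p k) = k := by
  unfold p Nat.primeCounting Nat.primeCounting'
  rw [Nat.count_nth_succ_of_infinite Nat.infinite_setOfPred_prime]
  omega

theorem tendsto_p : Tendsto p atTop atTop := by
  refine tendsto_atTop_mono (fun k => ?_) tendsto_id
  have := Nat.add_two_le_nth_prime (k - 1)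
  unfold p
  simp only [id]
  omega

/-- The prime number theorem for the `k`-th prime. -/
theorem p_isEquivalent : (fun k : ℕ => (p k : ℝ)) ~[atTop] fun k : ℕ => (k : ℝ) * log k := by
  have hx : Tendsto (fun k : ℕ => (p k : ℝ)) atTop atTop :=
    tendsto_natCast_atTop_atTop.comp tendsto_p
  refine (isEquivalent_mul_log_of_div_log tendsto_natCast_atTop_atTop hx ?_).2.symm
  refine (primeCounting_isEquivalent.comp_tendsto hx).congr_left ?_
  filter_upwards [eventually_ge_atTop 1] with k hk
  simp [primeCounting_p hk]

theorem log_const_mul_isEquivalent {α : Type*} {l : Filter α} {x : α → ℝ} {c : ℝ} (hc : 0 < c)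
    (hx : Tendsto x l atTop) : (fun i => log (c * x i)) ~[l] fun i => log (x i) := by
  have : (fun _ : α => log c) =o[l] fun i => log (x i) :=
    isLittleO_const_left.2 (Or.inr (tendsto_norm_atTop_atTop.comp (tendsto_log_atTop.comp hx)))
  refine (IsEquivalent.refl.add_isLittleO this).congr_left ?_
  filter_upwards [hx.eventually_gt_atTop 0] with i hi
  simp only [Pi.add_apply]
  rw [log_mul hc.ne' hi.ne', add_comm]

/-! ### Growth of the alternating sums -/

theorem A_nonneg (n : ℕ) : 0 ≤ A n := by
  have h : A 0 = 0 := by simp [A]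
  rw [← h]
  exact A_strictMono.monotone n.zero_le

theorem A_isEquivalent (hPillai : PillaiConjecture) :
    (fun n : ℕ => (A n : ℝ)) ~[atTop] fun n : ℕ => (n : ℝ) * log n := by
  have h2 : Tendsto (fun n : ℕ => 2 * n) atTop atTop :=
    tendsto_id.const_mul_atTop' (by norm_num)
  have h1 := hPillai.comp_tendsto h2
  have hp : (fun n : ℕ => (p (2 * n) : ℝ) / 2) ~[atTop] fun n : ℕ => (n : ℝ) * log n := by
    refine ((p_isEquivalent.comp_tendsto h2).div
      (IsEquivalent.refl (u := fun _ => (2 : ℝ)))).trans ?_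
    refine (IsEquivalent.refl (u := fun n : ℕ => (n : ℝ))).mul
      (log_const_mul_isEquivalent two_pos tendsto_natCast_atTop_atTop) |>.congr_left ?_
    refine Eventually.of_forall fun n => ?_
    simp only [Function.comp, Pi.mul_apply, Pi.div_apply]
    push_cast
    ring
  refine (h1.trans hp).congr_left (Eventually.of_forall fun n => ?_)
  have e : ∑ i ∈ Finset.Icc 1 (2 * n), (-1 : ℝ) ^ (i - 1) * (p i : ℝ) = -(A n : ℝ) := by
    unfold A
    push_cast
    rw [← Finset.sum_neg_distrib]
    refine Finset.sum_congr rfl fun i hi => ?_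
    obtain ⟨j, rfl⟩ : ∃ j, i = j + 1 := ⟨i - 1, by have := (Finset.mem_Icc.1 hi).1; omega⟩
    rw [Nat.add_sub_cancel, pow_succ]
    ring
  simp only [Function.comp]
  rw [e, abs_neg, abs_of_nonneg (by exact_mod_cast A_nonneg n)]

theorem T_isEquivalent (hPillai : PillaiConjecture) :
    (fun n : ℕ => (T n : ℝ)) ~[atTop] fun n : ℕ => (n : ℝ) * log n := by
  have hA := A_isEquivalent hPillai
  have ht : Tendsto (fun n : ℕ => (n : ℝ) * log n) atTop atTop :=
    tendsto_natCast_atTop_atTop.atTop_mul_atTop₀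
      (tendsto_log_atTop.comp tendsto_natCast_atTop_atTop)
  have h2 : (fun _ : ℕ => (2 : ℝ)) =o[atTop] fun n : ℕ => (n : ℝ) * log n :=
    isLittleO_const_left.2 (Or.inr (tendsto_norm_atTop_atTop.comp ht))
  refine (hA.sub_isLittleO h2).congr_left (Eventually.of_forall fun n => ?_)
  simp [T]

/-! ### Prime terms of an increasing sequence -/

open scoped Classical in
theorem primeCount_eq_count {a : ℕ → ℤ} (ha : StrictMono a) (n : ℕ) :
    primeCount a n = Nat.count (IsPrimeTerm a) (n + 1) := by
  have himg : {q : ℕ | q.Prime ∧ ∃ i, 1 ≤ i ∧ i ≤ n ∧ a i = q} =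
      (fun i => (a i).toNat) '' ((Finset.range (n + 1)).filter (IsPrimeTerm a) : Set ℕ) := by
    ext q
    simp only [Set.mem_ofPred_eq, Set.mem_image, Finset.coe_filter, Finset.mem_range]
    constructor
    · rintro ⟨hq, i, hi1, hin, hi⟩
      exact ⟨i, ⟨by omega, hi1, q, hq, hi⟩, by simp [hi]⟩
    · rintro ⟨i, ⟨hin, hi1, r, hr, hi⟩, rfl⟩
      simp only [hi, Int.toNat_natCast]
      exact ⟨hr, i, hi1, by omega, hi⟩
  unfold primeCount
  rw [himg, Set.InjOn.ncard_image, Set.ncard_coe_finset, Nat.count_eq_card_filter_range]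
  intro i hi j hj hij
  simp only [Finset.coe_filter, Set.mem_ofPred_eq] at hi hj
  obtain ⟨-, -, q, -, hq⟩ := hi
  obtain ⟨-, -, r, -, hr⟩ := hj
  simp only [hq, hr, Int.toNat_natCast] at hij
  exact ha.injective (by rw [hq, hr, hij])

theorem infinite_isPrimeTerm {a : ℕ → ℤ} (ha : StrictMono a)
    (hcount : (fun n : ℕ => (primeCount a n : ℝ)) ~[atTop] fun n : ℕ => 2 * (n : ℝ) / log n) :
    {n : ℕ | IsPrimeTerm a n}.Infinite := by
  classical
  intro hfin
  have hlim : Tendsto (fun n : ℕ => 2 * (n : ℝ) / log n) atTop atTop := by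
    have h0 : Tendsto (fun x : ℝ => log x / x) atTop (𝓝[>] 0) := by
      refine tendsto_nhdsWithin_iff.2 ⟨isLittleO_log_id_atTop.tendsto_div_nhds_zero, ?_⟩
      filter_upwards [eventually_gt_atTop 1] with x hx
      exact div_pos (log_pos hx) (by linarith)
    have h1 := (h0.inv_tendsto_nhdsGT_zero.const_mul_atTop two_pos).comp
      (tendsto_natCast_atTop_atTop (R := ℝ))
    refine h1.congr fun n => ?_
    simp [mul_div_assoc]
  have h1 := hcount.symm.tendsto_atTop hlim
  obtain ⟨n, hn⟩ := (h1.eventually_gt_atTop (hfin.toFinset.card : ℝ)).exists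
  have h2 : hfin.toFinset.card < primeCount a n := by exact_mod_cast hn
  rw [primeCount_eq_count ha, Nat.count_eq_card_filter_range] at h2
  refine absurd (Finset.card_le_card fun i hi => ?_) (not_le.2 h2)
  simpa using (Finset.mem_filter.1 hi).2

/-- If a strictly increasing integer sequence grows like `n log n` and has about `2 n / log n` primes
among its first `n` terms, then its `k`-th prime is asymptotic to `k (log k) ^ 2 / 2`. -/
theorem kthPrime_isEquivalent {a : ℕ → ℤ} (ha : StrictMono a)
    (hgrowth : (fun n : ℕ => (a n : ℝ)) ~[atTop] fun n : ℕ => (n : ℝ) * log n)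
    (hcount : (fun n : ℕ => (primeCount a n : ℝ)) ~[atTop] fun n : ℕ => 2 * (n : ℝ) / log n) :
    (fun k : ℕ => (kthPrime a k : ℝ)) ~[atTop] fun k : ℕ => (k : ℝ) * log k ^ 2 / 2 := by
  classical
  have hinf := infinite_isPrimeTerm ha hcount
  set N : ℕ → ℕ := fun k => Nat.nth (IsPrimeTerm a) (k - 1) with hN
  have hNt : Tendsto N atTop atTop :=
    (Nat.nth_strictMono hinf).tendsto_atTop.comp (tendsto_sub_atTop_nat 1)
  have hNr : Tendsto (fun k => (N k : ℝ)) atTop atTop := tendsto_natCast_atTop_atTop.comp hNt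
  have hkr : Tendsto (fun k : ℕ => (1 / 2 : ℝ) * k) atTop atTop :=
    tendsto_natCast_atTop_atTop.const_mul_atTop (by norm_num)
  have hhalf : (fun k : ℕ => (1 / 2 : ℝ) * k) ~[atTop] fun k => (N k : ℝ) / log (N k) := by
    have h := (IsEquivalent.refl (u := fun _ : ℕ => (1 / 2 : ℝ))).mul (hcount.comp_tendsto hNt)
    refine (h.congr_left ?_).congr_right (Eventually.of_forall fun k => ?_)
    · filter_upwards [eventually_ge_atTop 1] with k hk
      have : primeCount a (N k) = k := by
        rw [primeCount_eq_count ha, Nat.count_nth_succ_of_infinite hinf]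
        omega
      simp [this]
    · simp only [Pi.mul_apply, Function.comp]
      ring
  obtain ⟨hlogN, hNeq⟩ := isEquivalent_mul_log_of_div_log hkr hNr hhalf
  have hlogk : (fun k : ℕ => log ((1 / 2 : ℝ) * k)) ~[atTop] fun k : ℕ => log k :=
    log_const_mul_isEquivalent (by norm_num) tendsto_natCast_atTop_atTop
  have h := (hgrowth.comp_tendsto hNt).trans
    ((hNeq.symm.trans (IsEquivalent.refl.mul hlogk)).mul (hlogN.symm.trans hlogk))
  refine h.congr_right (Eventually.of_forall fun k => ?_)
  simp only [Pi.mul_apply]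
  ring

end AlternatingPrimes

/-- Under the two conjectures, each of the sequences `A` and `T` contains infinitely many primes
(so its `k`-th prime exists for every `k`), and its `k`-th prime is asymptotic to
`k (log k)^2 / 2`. -/
theorem corollary2p6
    (hPillai : AlternatingPrimes.PillaiConjecture)
    (hCount : AlternatingPrimes.PrimeCountConjecture) :
    ({n : ℕ | AlternatingPrimes.IsPrimeTerm AlternatingPrimes.A n}.Infinite ∧
      (fun k : ℕ => (AlternatingPrimes.kthPrime AlternatingPrimes.A k : ℝ)) ~[atTop]
        (fun k : ℕ => (k : ℝ) * Real.log k ^ 2 / 2)) ∧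
    ({n : ℕ | AlternatingPrimes.IsPrimeTerm AlternatingPrimes.T n}.Infinite ∧
      (fun k : ℕ => (AlternatingPrimes.kthPrime AlternatingPrimes.T k : ℝ)) ~[atTop]
        (fun k : ℕ => (k : ℝ) * Real.log k ^ 2 / 2)) :=
  ⟨⟨AlternatingPrimes.infinite_isPrimeTerm AlternatingPrimes.A_strictMono hCount.1,
    AlternatingPrimes.kthPrime_isEquivalent AlternatingPrimes.A_strictMono
      (AlternatingPrimes.A_isEquivalent hPillai) hCount.1⟩,
    AlternatingPrimes.infinite_isPrimeTerm AlternatingPrimes.T_strictMono hCount.2,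
    AlternatingPrimes.kthPrime_isEquivalent AlternatingPrimes.T_strictMono
      (AlternatingPrimes.T_isEquivalent hPillai) hCount.2⟩
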